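/- For a finite field $\mathbb F_q$ of order $q$, a rank-metric code in $\mathbb F_q^{m\times n}$ ($n\le m$) is an $\mathbb F_q$-subspace $\mathcal C\subseteq\mathbb F_q^{m\times n}$; its rank distance is $\min\{\operatorname{rk}A : A\in\mathcal C\setminus\{0\}\}$. It is an $[m\times n;\delta]$-MRD code (over $\mathbb F_q$) if it has rank distance $\delta$ and dimension $m(n-\delta+1)$. Thus an $[m\times 2;2]$-MRD code is an $m$-dimensional code in $\mathbb F_q^{m\times 2}$ of rank distance $2$. Let $s_m(q)$ be the number of matrices in $\mathbb F_q^{m\times m}$ that have no eigenvalue in $\mathbb F_q$. Let $m\ge 2$. 1. For every prime power $q$: let $a^\alpha_i$ ($1\le\alpha,i\le m$) be independent and uniformly distributed on $\mathbb F_q$, and let $A_\alpha\in\mathbb F_q^{m\times 2}$ be the matrix with first column the standard basis vector $e_\alpha$ and second column $(a^\alpha_1,\dots,a^\alpha_m)^{\sf T}$. Then $$\mathrm{Prob}\big(\langle A_1,\dots,A_m\rangle\text{ is an }[m\times2;2]\text{-MRD code}\big)=\frac{s_m(q)}{q^{m^2}}.$$ 2. For every prime power $q$, the number of $[m\times2;2]$-MRD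 codes over $\mathbb F_q$ divided by the number of all $m$-dimensional subspaces of $\mathbb F_q^{m\times 2}$ equals $$\frac{s_m(q)}{q^{m^2}}\cdot\frac{\prod_{i=0}^{m-1}(q^{2m}-q^{i+m})}{\prod_{i=0}^{m-1}(q^{2m}-q^{i})}.$$ 3. As $q\to\infty$ through the prime powers ($m$ fixed), the probability in 1 and the proportion in 2 both converge to $\sum_{j=0}^m\frac{(-1)^j}{j!}$. This limit satisfies $\big|\sum_{j=0}^m\frac{(-1)^j}{j!}-\frac1e\big|\le\frac1{(m+1)!}$, and it lies in $[0.333,\,0.375]$ whenever $m\ge 3$. -/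

import Mathlib

open Filter Topology MeasureTheory

/-- A rank-metric code: an `F`-subspace of the space of `m × n` matrices over `F`. -/
abbrev RankMetricCode (F : Type*) [Field F] (m n : ℕ) : Type _ :=
  Submodule F (Matrix (Fin m) (Fin n) F)

/-- The rank distance `min {rk A | A ∈ C, A ≠ 0}` of a code (with value `0` for the zero code). -/
noncomputable def rankDistance {F : Type*} [Field F] {m n : ℕ} (C : RankMetricCode F m n) : ℕ :=
  sInf {r : ℕ | ∃ A ∈ C, A ≠ 0 ∧ A.rank = r}

/-- `C` is an `[m × n; δ]`-MRD code (where `n ≤ m` and `1 ≤ δ ≤ n`): its rank distance is `δ` and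
its dimension attains the Singleton bound `m (n - δ + 1)`. -/
def IsMRD {F : Type*} [Field F] {m n : ℕ} (C : RankMetricCode F m n) (δ : ℕ) : Prop :=
  Module.finrank F C = m * (n - δ + 1) ∧ rankDistance C = δ

/-- The set of eigenvalues in `F` of a square matrix over `F`. -/
def eigenvalueSet {F : Type*} [Field F] {m : ℕ} (A : Matrix (Fin m) (Fin m) F) : Set F :=
  {c : F | Module.End.HasEigenvalue (Matrix.toLin' A) c}

/-- The number `s_m(q)` of `m × m` matrices over the field `F` of order `q` without eigenvalues
in `F`. -/
noncomputable def spectrumFreeCount (F : Type*) [Field F] (m : ℕ) : ℕ :=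
  {A : Matrix (Fin m) (Fin m) F | eigenvalueSet A = ∅}.ncard

/-- The `m × 2` matrix whose first column is the standard basis vector `e_α` and whose second
column has the entries `a α i`, for `i = 1, …, m`. -/
def normalizedGenerator {F : Type*} [Field F] {m : ℕ} (a : Fin m → Fin m → F) (α : Fin m) :
    Matrix (Fin m) (Fin 2) F :=
  Matrix.of fun i => ![if i = α then 1 else 0, a α i]

/-- The code generated by the `m` normalized matrices. -/
def normalizedCode {F : Type*} [Field F] {m : ℕ} (a : Fin m → Fin m → F) :
    RankMetricCode F m 2 :=
  Submodule.span F (Set.range (normalizedGenerator a))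

/-- The probability that `m` normalized generators, whose free entries are independent and
uniformly distributed on the finite field `F`, generate an `[m × 2; 2]`-MRD code. -/
noncomputable def normalizedMRDProb (F : Type*) [Field F] [Fintype F] (m : ℕ) : ℝ :=
  letI : MeasurableSpace F := ⊤
  (Measure.pi fun _ : Fin m => Measure.pi fun _ : Fin m =>
    (PMF.uniformOfFintype F).toMeasure).real
      {a : Fin m → Fin m → F | IsMRD (normalizedCode a) 2}

/-- The proportion of `[m × 2; 2]`-MRD codes among all `m`-dimensional codes of `m × 2` matrices
over `F`. -/
noncomputable def mrdProportion (F : Type*) [Field F] (m : ℕ) : ℝ :=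
  ({C : RankMetricCode F m 2 | Module.finrank F C = m ∧ IsMRD C 2}.ncard : ℝ) /
    ({C : RankMetricCode F m 2 | Module.finrank F C = m}.ncard : ℝ)

/-! A codeword of rank 2 has nonzero first column, so on an MRD code the projection to the first
column is bijective. Hence the MRD codes are exactly the codes {(x | Bx)} with B having no
eigenvector, and B is determined by the code (`isMRD_normalizedCode_iff`,
`IsMRD.exists_eq_normalizedCode`, `normalizedCode_injective`). This gives the probability at once.
The proportion follows after counting `m`-dimensional subspaces by their bases.

For the limit, let X be the number of distinct eigenvalues of a random endomorphism of V. Since X ≤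
m, inclusion-exclusion gives P(X = 0) = ∑ (-1)^k/k! · E[X(X-1)⋯(X-k+1)] over k ≤ m, so it suffices
that each of these factorial moments tends to 1. Count eigenvectors instead of eigenvalues:
eigenvectors for distinct scalars are independent, and an independent k-tuple has prescribed images
under exactly |End V|/|V|^k endomorphisms, so their moment is exact (`eigenvectorMoment_mul`). After
division by (q-1)^k it tends to 1 and bounds the moment of X from above. The excess comes only from
eigenspaces of dimension at least 2. Those supply k+1 independent eigenvectors for just k scalars,
so the excess is O(1/q) (`eigenvectorMoment_le`). -/

/-! ### Double counting of endomorphisms and eigenvectors. -/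

section EigenvectorCounting

variable {F V : Type*} [Field F] [AddCommGroup V] [Module F V]

/-- Prescribing the values of an endomorphism on a linearly independent family divides the number
of endomorphisms by `|V| ^ |ι|`. -/
theorem card_end_extending_mul [Finite V] {ι : Type*} [Fintype ι] {v : ι → V}
    (hv : LinearIndependent F v) (w : ι → V) :
    Nat.card {f : Module.End F V // ∀ i, f (v i) = w i} * Nat.card V ^ Fintype.card ι =
      Nat.card (Module.End F V) := by
  let φ : Module.End F V →ₗ[F] (ι → V) := LinearMap.pi fun i => LinearMap.applyₗ (v i)
  have hφ : ∀ f i, φ f i = f (v i) := fun f i => rfl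
  have hsurj : Function.Surjective φ := fun u =>
    ⟨(Module.Basis.extend hv.linearIndepOn_id).constr F
        (fun x => Function.extend v u 0 x), by
      funext i
      have hmem : v i ∈ (hv.linearIndepOn_id).extend (Set.subset_univ _) :=
        Module.Basis.subset_extend hv.linearIndepOn_id ⟨i, rfl⟩
      have hb : Module.Basis.extend hv.linearIndepOn_id ⟨v i, hmem⟩ = v i :=
        Module.Basis.extend_apply_self _ _
      rw [hφ]
      conv_lhs => rw [← hb]
      rw [Module.Basis.constr_basis, hv.injective.extend_apply]⟩
  -- A section of sets suffices: translating by its values identifies every fibre of `φ` with the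
  -- fibre over `w`.
  let s : (ι → V) → Module.End F V := Function.surjInv hsurj
  have hs : ∀ u, φ (s u) = u := Function.surjInv_eq hsurj
  have hmem : ∀ f, (∀ i, f (v i) = w i) ↔ φ f = w := fun f => by
    rw [funext_iff]; rfl
  let e : {f : Module.End F V // ∀ i, f (v i) = w i} × (ι → V) ≃ Module.End F V :=
    { toFun := fun p => p.1.1 + s p.2
      invFun := fun g => (⟨g - s (φ g - w), by rw [hmem, map_sub, hs]; abel⟩, φ g - w)
      left_inv := by
        rintro ⟨⟨f, hf⟩, u⟩
        rw [hmem] at hf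
        simp [hf, hs]
      right_inv := fun g => by simp }
  rw [← Nat.card_congr e, Nat.card_prod, Nat.card_fun, Nat.card_eq_fintype_card (α := ι)]

theorem card_eigenvector_tuples [Fintype V] (f : Module.End F V) {ι : Type*} [Fintype ι]
    (c : ι → F) :
    Nat.card {v : ι → V // ∀ i, f.HasEigenvector (c i) (v i)} =
      ∏ i, (Nat.card (f.eigenspace (c i)) - 1) := by
  classical
  rw [Nat.card_congr (Equiv.subtypePiEquivPi (p := fun i x => f.HasEigenvector (c i) x)),
    Nat.card_pi]
  refine Finset.prod_congr rfl fun i _ => ?_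
  have h : {x | f.HasEigenvector (c i) x} = (f.eigenspace (c i) : Set V) \ {0} := by
    ext x; simp [Module.End.hasEigenvector_iff]
  change Nat.card ({x | f.HasEigenvector (c i) x} : Set V) = _
  rw [h, Nat.card_coe_set_eq, Set.ncard_sdiff_singleton_of_mem (zero_mem _),
    ← Nat.card_coe_set_eq]
  rfl

/-- Double counting of pairs of an endomorphism and a linearly independent family of eigenvectors
for given eigenvalues. -/
theorem sum_card_independent_eigenvectors_mul [Fintype V] [Fintype (Module.End F V)] {ι : Type*}
    [Fintype ι] (c : ι → F) :
    (∑ f : Module.End F V,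
        Nat.card {v : ι → V // LinearIndependent F v ∧ ∀ i, f (v i) = c i • v i}) *
        Nat.card V ^ Fintype.card ι =
      Nat.card {v : ι → V // LinearIndependent F v} * Nat.card (Module.End F V) := by
  classical
  have key := Finset.sum_card_bipartiteAbove_eq_sum_card_bipartiteBelow
    (fun (f : Module.End F V) (v : ι → V) => ∀ i, f (v i) = c i • v i)
    (s := Finset.univ) (t := Finset.univ.filter fun v : ι → V => LinearIndependent F v)
  have h1 : ∀ f : Module.End F V,
      Nat.card {v : ι → V // LinearIndependent F v ∧ ∀ i, f (v i) = c i • v i} =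
      (Finset.bipartiteAbove (fun (f : Module.End F V) (v : ι → V) => ∀ i, f (v i) = c i • v i)
        (Finset.univ.filter fun v : ι → V => LinearIndependent F v) f).card := fun f => by
    rw [Nat.card_eq_fintype_card, Fintype.card_subtype, Finset.bipartiteAbove,
      Finset.filter_filter]
  rw [Finset.sum_congr rfl fun f _ => h1 f, key, Finset.sum_mul,
    Finset.sum_congr rfl (g := fun _ => Nat.card (Module.End F V)), Finset.sum_const,
    Nat.card_eq_fintype_card (α := {v : ι → V // LinearIndependent F v}), Fintype.card_subtype,
    smul_eq_mul]
  intro v hv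
  rw [← card_end_extending_mul (Finset.mem_filter.1 hv).2 fun i => c i • v i,
    Nat.card_eq_fintype_card (α := {f : Module.End F V // _}), Fintype.card_subtype,
    Finset.bipartiteBelow]

/-- If `w` were a combination of the `v j`, applying `f - c i` would kill `w`. Independence of the
`v j` and distinctness of the `c j` then annihilate every coefficient except that of `v i`, putting
`w` on the excluded line. -/
theorem linearIndependent_cons_of_hasEigenvector {f : Module.End F V} {k : ℕ} {c : Fin k → F}
    (hc : Function.Injective c) {v : Fin k → V} (hv : ∀ j, f.HasEigenvector (c j) (v j))
    {i : Fin k} {w : V} (hw : f w = c i • w) (hwi : w ∉ Submodule.span F {v i}) :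
    LinearIndependent F (Fin.cons w v : Fin (k + 1) → V) := by
  have hli := f.eigenvectors_linearIndependent' c hc v hv
  rw [linearIndependent_finCons]
  refine ⟨hli, fun hmem => hwi ?_⟩
  obtain ⟨a, ha⟩ := (Submodule.mem_span_range_iff_exists_fun F).1 hmem
  have h0 : ∑ j, (a j * (c j - c i)) • v j = 0 := by
    have h1 : f w - c i • w = 0 := by rw [hw, sub_self]
    rw [← ha, map_sum, Finset.smul_sum, ← Finset.sum_sub_distrib] at h1
    rw [← h1]
    refine Finset.sum_congr rfl fun j _ => ?_
    rw [map_smul, (hv j).apply_eq_smul]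
    module
  have hz := Fintype.linearIndependent_iff.1 hli _ h0
  have : w = a i • v i := by
    rw [← ha]
    refine Finset.sum_eq_single i (fun j _ hj => ?_) (by simp)
    rcases mul_eq_zero.1 (hz j) with h | h
    · rw [h, zero_smul]
    · exact absurd (hc (sub_eq_zero.1 h)) hj
  exact this ▸ Submodule.smul_mem _ _ (Submodule.mem_span_singleton_self _)

/-- Each eigenvector tuple extends by any vector of the `c i`-eigenspace off the line of `v i`, a
line with `q` elements. -/
theorem prod_mul_le_card_independent_eigenvectors [Fintype F] [Fintype V] (f : Module.End F V)
    {k : ℕ} {c : Fin k → F} (hc : Function.Injective c) (i : Fin k) :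
    (∏ j, (Nat.card (f.eigenspace (c j)) - 1)) *
        (Nat.card (f.eigenspace (c i)) - Fintype.card F) ≤
      Nat.card {v : Fin (k + 1) → V // LinearIndependent F v ∧
        ∀ j, f (v j) = (Fin.cons (c i) c : Fin (k + 1) → F) j • v j} := by
  classical
  rw [← card_eigenvector_tuples]
  have hfib : ∀ v : {v : Fin k → V // ∀ i, f.HasEigenvector (c i) (v i)},
      Nat.card {w : V // f w = c i • w ∧ w ∉ Submodule.span F {v.1 i}} =
        Nat.card (f.eigenspace (c i)) - Fintype.card F := fun v => by
    have h : {w : V | f w = c i • w ∧ w ∉ Submodule.span F {v.1 i}} =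
        (f.eigenspace (c i) : Set V) \ (Submodule.span F {v.1 i} : Set V) := by
      ext w; simp
    change Nat.card ({w : V | f w = c i • w ∧ w ∉ Submodule.span F {v.1 i}} : Set V) = _
    have hsub : (Submodule.span F {v.1 i} : Set V) ⊆ f.eigenspace (c i) := by
      rw [SetLike.coe_subset_coe, Submodule.span_singleton_le_iff_mem]
      exact (v.2 i).1
    rw [h, Nat.card_coe_set_eq, Set.ncard_sdiff hsub, ← Nat.card_coe_set_eq,
      ← Nat.card_coe_set_eq]
    congr 1
    change Nat.card (Submodule.span F {v.1 i}) = _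
    rw [Module.natCard_eq_pow_finrank (K := F), finrank_span_singleton (v.2 i).2, pow_one,
      Nat.card_eq_fintype_card]
  have hsig : Nat.card (Σ v : {v : Fin k → V // ∀ i, f.HasEigenvector (c i) (v i)},
      {w : V // f w = c i • w ∧ w ∉ Submodule.span F {v.1 i}}) =
      Nat.card {v : Fin k → V // ∀ i, f.HasEigenvector (c i) (v i)} *
        (Nat.card (f.eigenspace (c i)) - Fintype.card F) := by
    rw [Nat.card_sigma, Finset.sum_congr rfl fun v _ => hfib v, Finset.sum_const,
      Nat.card_eq_fintype_card (α := {v : Fin k → V // _}), smul_eq_mul, Finset.card_univ]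
  rw [← hsig]
  refine Nat.card_le_card_of_injective (fun p => ⟨Fin.cons p.2.1 p.1.1,
    linearIndependent_cons_of_hasEigenvector hc p.1.2 p.2.2.1 p.2.2.2, fun j => ?_⟩) ?_
  · refine Fin.cases ?_ (fun j => ?_) j
    · simpa using p.2.2.1
    · simpa using (p.1.2 j).apply_eq_smul
  · rintro ⟨⟨v, hv⟩, ⟨w, hw⟩⟩ ⟨⟨v', hv'⟩, ⟨w', hw'⟩⟩ h
    have h' : (Fin.cons w v : Fin (k + 1) → V) = Fin.cons w' v' := congrArg Subtype.val h
    obtain ⟨rfl, rfl⟩ := Fin.cons_injective2 h'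
    rfl

/-- The number of injective tuples of eigenvalues, weighted by `(q - 1) ^ k`, is at most the number
of tuples of eigenvectors. -/
theorem ite_le_prod_card_eigenspace [Fintype F] [Fintype V] (f : Module.End F V) {k : ℕ}
    (c : Fin k → F) [Decidable (∀ i, f.HasEigenvalue (c i))] :
    (if ∀ i, f.HasEigenvalue (c i) then (Fintype.card F - 1) ^ k else 0) ≤
      ∏ i, (Nat.card (f.eigenspace (c i)) - 1) := by
  split_ifs with h
  · calc (Fintype.card F - 1) ^ k = ∏ _i : Fin k, (Fintype.card F - 1) := by simp
      _ ≤ _ := Finset.prod_le_prod' fun i _ => Nat.sub_le_sub_right ?_ 1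
    rw [Module.natCard_eq_pow_finrank (K := F), Nat.card_eq_fintype_card]
    refine Nat.le_self_pow ?_ _
    rw [Ne, Submodule.finrank_eq_zero]
    exact (h i)
  · exact Nat.zero_le _

/-- If all eigenspaces are lines, the first term on the right is already an equality. If one has
dimension at least 2, its size minus `q` is at least `q - 1`, so the tuples of length `k + 1` absorb
the left side. If some `c i` is not an eigenvalue, the left side vanishes. -/
theorem prod_card_eigenspace_le [Fintype F] [Fintype V] (f : Module.End F V) {k : ℕ}
    {c : Fin k → F} (hc : Function.Injective c) [Decidable (∀ i, f.HasEigenvalue (c i))] :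
    (Fintype.card F - 1) * ∏ i, (Nat.card (f.eigenspace (c i)) - 1) ≤
      (Fintype.card F - 1) *
          (if ∀ i, f.HasEigenvalue (c i) then (Fintype.card F - 1) ^ k else 0) +
        ∑ i, Nat.card {v : Fin (k + 1) → V // LinearIndependent F v ∧
          ∀ j, f (v j) = (Fin.cons (c i) c : Fin (k + 1) → F) j • v j} := by
  have hq : 2 ≤ Fintype.card F := Fintype.one_lt_card
  have hcard : ∀ i, Nat.card (f.eigenspace (c i)) =
      Fintype.card F ^ Module.finrank F (f.eigenspace (c i)) := fun i => by
    rw [Module.natCard_eq_pow_finrank (K := F), Nat.card_eq_fintype_card]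
  by_cases h : ∀ i, f.HasEigenvalue (c i)
  · rw [if_pos h]
    by_cases h1 : ∃ i, 2 ≤ Module.finrank F (f.eigenspace (c i))
    · obtain ⟨i, hi⟩ := h1
      refine le_trans ?_ (Nat.le_add_left _ _)
      refine le_trans ?_ (Finset.single_le_sum (fun _ _ => Nat.zero_le _) (Finset.mem_univ i))
      refine le_trans ?_ (prod_mul_le_card_independent_eigenvectors f hc i)
      rw [mul_comm]
      refine Nat.mul_le_mul_left _ ?_
      have : Fintype.card F ^ 2 ≤ Nat.card (f.eigenspace (c i)) := by
        rw [hcard]; exact Nat.pow_le_pow_right (by omega) hi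
      have h4 : 2 * Fintype.card F ≤ Fintype.card F ^ 2 := by nlinarith
      omega
    · push Not at h1
      refine le_trans (le_of_eq ?_) (Nat.le_add_right _ _)
      congr 1
      rw [Finset.prod_congr rfl (g := fun _ => Fintype.card F - 1) fun i _ => ?_]
      · simp
      · have h2 : Module.finrank F (f.eigenspace (c i)) ≠ 0 := by
          rw [Ne, Submodule.finrank_eq_zero]; exact h i
        rw [hcard, show Module.finrank F (f.eigenspace (c i)) = 1 by have := h1 i; omega, pow_one]
  · push Not at h
    obtain ⟨i, hi⟩ := h
    rw [Finset.prod_eq_zero (Finset.mem_univ i)]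
    · simp
    · rw [hcard, Submodule.finrank_eq_zero.2 (not_not.1 hi)]; simp

/-- Distinct scalars make independence automatic, so the product counts exactly the independent
tuples of the double count. -/
theorem sum_prod_card_eigenspace_mul [Fintype V] [Fintype (Module.End F V)] {k : ℕ}
    {c : Fin k → F} (hc : Function.Injective c) :
    (∑ f : Module.End F V, ∏ i, (Nat.card (f.eigenspace (c i)) - 1)) * Nat.card V ^ k =
      Nat.card {v : Fin k → V // LinearIndependent F v} * Nat.card (Module.End F V) := by
  rw [← sum_card_independent_eigenvectors_mul c, Fintype.card_fin]
  congr 1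
  refine Finset.sum_congr rfl fun f _ => ?_
  rw [← card_eigenvector_tuples]
  refine Nat.card_congr (Equiv.subtypeEquivRight fun v => ⟨fun h =>
    ⟨f.eigenvectors_linearIndependent' c hc v h, fun i => (h i).apply_eq_smul⟩, fun h i =>
    ⟨Module.End.mem_eigenspace_iff.2 (h.2 i), h.1.ne_zero i⟩⟩)

/-- The scalars may repeat here, as the error term with a doubled eigenvalue requires. -/
theorem sum_card_independent_eigenvectors_le [Fintype V] [Fintype (Module.End F V)] {k : ℕ}
    (c : Fin k → F) :
    ∑ f : Module.End F V, Nat.card {v : Fin k → V // LinearIndependent F v ∧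
        ∀ j, f (v j) = c j • v j} ≤ Nat.card (Module.End F V) := by
  have h := sum_card_independent_eigenvectors_mul (V := V) c
  have hle : Nat.card {v : Fin k → V // LinearIndependent F v} ≤ Nat.card V ^ k := by
    refine (Nat.card_le_card_of_injective _ Subtype.val_injective).trans (le_of_eq ?_)
    rw [Nat.card_fun, Nat.card_eq_fintype_card (α := Fin k), Fintype.card_fin]
  have hpos : 0 < Nat.card V ^ k := pow_pos Nat.card_pos _
  rw [Fintype.card_fin] at h
  refine Nat.le_of_mul_le_mul_right ?_ hpos
  rw [h, mul_comm]
  exact Nat.mul_le_mul_left _ hle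

end EigenvectorCounting

/-! ### Factorial moments of the number of eigenvalues. -/

section EigenvalueMoments

variable {F V : Type*} [Field F] [Fintype F] [AddCommGroup V] [Module F V]

open Classical in
theorem sum_embedding_ite_hasEigenvalue (f : Module.End F V) (k : ℕ) :
    (∑ c : Fin k ↪ F, if ∀ i, f.HasEigenvalue (c i) then 1 else 0) =
      {μ : F | f.HasEigenvalue μ}.ncard.descFactorial k := by
  rw [Finset.sum_boole, Nat.cast_id, ← Nat.card_coe_set_eq, Nat.card_eq_fintype_card]
  conv_rhs => rw [← Fintype.card_fin k, ← Fintype.card_embedding_eq]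
  rw [← Fintype.card_subtype]
  exact Fintype.card_congr
    { toFun := fun c => ⟨fun i => ⟨c.1 i, c.2 i⟩, fun i j h =>
        c.1.injective (congrArg Subtype.val h)⟩
      invFun := fun d => ⟨d.trans (Function.Embedding.subtype _), fun i => (d i).2⟩
      left_inv := fun c => rfl
      right_inv := fun d => rfl }

theorem ncard_eigenvalues_le_finrank [Module.Finite F V] (f : Module.End F V) :
    {μ : F | f.HasEigenvalue μ}.ncard ≤ Module.finrank F V := by
  classical
  choose! v hv using fun (μ : F) (h : f.HasEigenvalue μ) => h.exists_hasEigenvector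
  have h := (f.eigenvectors_linearIndependent' (fun μ : {μ : F | f.HasEigenvalue μ} => (μ : F))
    Subtype.val_injective (fun μ => v μ) fun μ => hv μ μ.2).fintype_card_le_finrank
  rwa [← Nat.card_eq_fintype_card, Nat.card_coe_set_eq] at h

variable (F V) [Fintype (Module.End F V)]

/-- The sum of the falling factorials of order `k` of the number of eigenvalues, over all
endomorphisms of `V`. -/
noncomputable def eigenvalueMoment (k : ℕ) : ℕ :=
  ∑ f : Module.End F V, {μ : F | f.HasEigenvalue μ}.ncard.descFactorial k

variable {F V}

open Classical in
theorem sum_sum_ite_hasEigenvalue (k a : ℕ) :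
    ∑ c : Fin k ↪ F, ∑ f : Module.End F V, (if ∀ i, f.HasEigenvalue (c i) then a else 0) =
      a * eigenvalueMoment F V k := by
  rw [Finset.sum_comm, eigenvalueMoment, Finset.mul_sum]
  refine Finset.sum_congr rfl fun f _ => ?_
  rw [← sum_embedding_ite_hasEigenvalue, Finset.mul_sum]
  simp only [mul_ite, mul_one, mul_zero]

variable (F V) [Fintype V]

/-- The number of triples of an endomorphism, `k` distinct scalars, and eigenvectors for them. -/
noncomputable def eigenvectorMoment (k : ℕ) : ℕ :=
  ∑ c : Fin k ↪ F, ∑ f : Module.End F V, ∏ i, (Nat.card (f.eigenspace (c i)) - 1)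

variable {F V}

theorem pow_mul_eigenvalueMoment_le (k : ℕ) :
    (Fintype.card F - 1) ^ k * eigenvalueMoment F V k ≤ eigenvectorMoment F V k := by
  classical
  rw [← sum_sum_ite_hasEigenvalue]
  exact Finset.sum_le_sum fun c _ => Finset.sum_le_sum fun f _ => ite_le_prod_card_eigenspace f c

/-- The error term collects at most `q ^ k` choices of scalars and `k` choices of the repeated one,
each contributing at most `|End V|`. -/
theorem eigenvectorMoment_le (k : ℕ) :
    (Fintype.card F - 1) * eigenvectorMoment F V k ≤
      (Fintype.card F - 1) ^ (k + 1) * eigenvalueMoment F V k +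
        Fintype.card F ^ k * (k * Nat.card (Module.End F V)) := by
  classical
  have h1 : (Fintype.card F - 1) * eigenvectorMoment F V k ≤
      ∑ c : Fin k ↪ F, ∑ f : Module.End F V, ((Fintype.card F - 1) *
          (if ∀ i, f.HasEigenvalue (c i) then (Fintype.card F - 1) ^ k else 0) +
        ∑ i, Nat.card {v : Fin (k + 1) → V // LinearIndependent F v ∧
          ∀ j, f (v j) = (Fin.cons (c i) c : Fin (k + 1) → F) j • v j}) := by
    simp only [eigenvectorMoment, Finset.mul_sum]
    exact Finset.sum_le_sum fun c _ => Finset.sum_le_sum fun f _ =>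
      prod_card_eigenspace_le f c.injective
  refine h1.trans ?_
  simp only [Finset.sum_add_distrib, ← Finset.mul_sum]
  rw [sum_sum_ite_hasEigenvalue, pow_succ' _ k, mul_assoc]
  refine Nat.add_le_add_left ?_ _
  calc _ ≤ ∑ _c : Fin k ↪ F, k * Nat.card (Module.End F V) := by
        refine Finset.sum_le_sum fun c _ => ?_
        rw [Finset.sum_comm]
        refine (Finset.sum_le_sum fun i _ =>
          sum_card_independent_eigenvectors_le (V := V) (Fin.cons (c i) c)).trans ?_
        simp
    _ = (Fintype.card F).descFactorial k * (k * Nat.card (Module.End F V)) := by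
        rw [Finset.sum_const, Finset.card_univ, Fintype.card_embedding_eq, Fintype.card_fin,
          smul_eq_mul]
    _ ≤ _ := Nat.mul_le_mul_right _ (Nat.descFactorial_le_pow _ _)

theorem eigenvectorMoment_mul {k : ℕ} (hk : k ≤ Module.finrank F V) :
    eigenvectorMoment F V k * (Fintype.card F ^ Module.finrank F V) ^ k =
      (Fintype.card F).descFactorial k *
        ((∏ i : Fin k, (Fintype.card F ^ Module.finrank F V - Fintype.card F ^ (i : ℕ))) *
          Nat.card (Module.End F V)) := by
  have hV : Fintype.card F ^ Module.finrank F V = Nat.card V := by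
    rw [Module.natCard_eq_pow_finrank (K := F), Nat.card_eq_fintype_card]
  rw [← card_linearIndependent hk, hV, eigenvectorMoment, Finset.sum_mul,
    Finset.sum_congr rfl fun c _ => sum_prod_card_eigenspace_mul c.injective, Finset.sum_const,
    Finset.card_univ, Fintype.card_embedding_eq, Fintype.card_fin, smul_eq_mul]

/-- The expected number of `k`-tuples of eigenlines with distinct eigenvalues of a random
endomorphism of an `m`-dimensional space over a field of order `q`. -/
noncomputable def expectedEigenlineTuples (m k q : ℕ) : ℝ :=
  (q.descFactorial k : ℝ) / ((q : ℝ) - 1) ^ k *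
    ∏ i ∈ Finset.range k, (1 - (q : ℝ) ^ i / (q : ℝ) ^ m)

theorem eigenvectorMoment_div {k : ℕ} (hk : k ≤ Module.finrank F V) :
    (eigenvectorMoment F V k : ℝ) / ((Fintype.card F : ℝ) - 1) ^ k / Nat.card (Module.End F V) =
      expectedEigenlineTuples (Module.finrank F V) k (Fintype.card F) := by
  have h := congrArg (Nat.cast : ℕ → ℝ) (eigenvectorMoment_mul (V := V) hk)
  have hq : (0 : ℝ) < Fintype.card F := Nat.cast_pos.2 Fintype.card_pos
  have hq1 : (0 : ℝ) < (Fintype.card F : ℝ) - 1 := by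
    rw [sub_pos]; exact_mod_cast Fintype.one_lt_card
  have hN : (0 : ℝ) < Nat.card (Module.End F V) := Nat.cast_pos.2 Nat.card_pos
  have hprod : ((∏ i : Fin k, (Fintype.card F ^ Module.finrank F V - Fintype.card F ^ (i : ℕ)) :
      ℕ) : ℝ) = (∏ i ∈ Finset.range k, (1 - (Fintype.card F : ℝ) ^ i /
        (Fintype.card F : ℝ) ^ Module.finrank F V)) *
          ((Fintype.card F : ℝ) ^ Module.finrank F V) ^ k := by
    rw [← Fin.prod_univ_eq_prod_range
      (fun i => 1 - (Fintype.card F : ℝ) ^ i / (Fintype.card F : ℝ) ^ Module.finrank F V),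
      Nat.cast_prod]
    have hconst : ((Fintype.card F : ℝ) ^ Module.finrank F V) ^ k =
        ∏ _i : Fin k, (Fintype.card F : ℝ) ^ Module.finrank F V := by simp
    rw [hconst, ← Finset.prod_mul_distrib]
    refine Finset.prod_congr rfl fun i _ => ?_
    rw [Nat.cast_sub (Nat.pow_le_pow_right Fintype.card_pos (i.2.le.trans hk))]
    push_cast
    field_simp
  rw [Nat.cast_mul, Nat.cast_mul, Nat.cast_mul, hprod, Nat.cast_pow, Nat.cast_pow] at h
  have hpos : (0 : ℝ) < ((Fintype.card F : ℝ) ^ Module.finrank F V) ^ k := by positivity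
  have h' : (eigenvectorMoment F V k : ℝ) = (Fintype.card F).descFactorial k *
      (∏ i ∈ Finset.range k, (1 - (Fintype.card F : ℝ) ^ i /
        (Fintype.card F : ℝ) ^ Module.finrank F V)) * Nat.card (Module.End F V) := by
    refine mul_right_cancel₀ hpos.ne' ?_
    rw [h]; ring
  rw [h', expectedEigenlineTuples]
  field_simp

theorem eigenvalueMoment_div_le {k : ℕ} (hk : k ≤ Module.finrank F V) :
    (eigenvalueMoment F V k : ℝ) / Nat.card (Module.End F V) ≤
      expectedEigenlineTuples (Module.finrank F V) k (Fintype.card F) := by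
  rw [← eigenvectorMoment_div hk]
  have hq1 : (0 : ℝ) < (Fintype.card F : ℝ) - 1 := by
    rw [sub_pos]; exact_mod_cast Fintype.one_lt_card
  refine div_le_div_of_nonneg_right ?_ (Nat.cast_nonneg _)
  rw [le_div_iff₀ (pow_pos hq1 k), mul_comm]
  have h := (Nat.cast_le (α := ℝ)).2 (pow_mul_eigenvalueMoment_le (F := F) (V := V) k)
  rwa [Nat.cast_mul, Nat.cast_pow, Nat.cast_sub Fintype.card_pos, Nat.cast_one] at h

theorem le_eigenvalueMoment_div {k : ℕ} (hk : k ≤ Module.finrank F V) :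
    expectedEigenlineTuples (Module.finrank F V) k (Fintype.card F) -
        k * ((Fintype.card F : ℝ) ^ k / ((Fintype.card F : ℝ) - 1) ^ (k + 1)) ≤
      (eigenvalueMoment F V k : ℝ) / Nat.card (Module.End F V) := by
  rw [← eigenvectorMoment_div hk]
  have hq1 : (0 : ℝ) < (Fintype.card F : ℝ) - 1 := by
    rw [sub_pos]; exact_mod_cast Fintype.one_lt_card
  have hN : (0 : ℝ) < Nat.card (Module.End F V) := Nat.cast_pos.2 Nat.card_pos
  have h := (Nat.cast_le (α := ℝ)).2 (eigenvectorMoment_le (F := F) (V := V) k)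
  rw [Nat.cast_add, Nat.cast_mul, Nat.cast_mul, Nat.cast_pow,
    Nat.cast_sub Fintype.card_pos, Nat.cast_one] at h
  push_cast at h
  set p := (Fintype.card F : ℝ) - 1
  set N : ℝ := (Nat.card (Module.End F V) : ℝ)
  rw [sub_le_iff_le_add]
  have e : (eigenvalueMoment F V k : ℝ) / N + k * ((Fintype.card F : ℝ) ^ k / p ^ (k + 1)) =
      (p ^ (k + 1) * eigenvalueMoment F V k + (Fintype.card F : ℝ) ^ k * (k * N)) /
        (p ^ (k + 1) * N) := by
    field_simp
  rw [e, div_div, div_le_div_iff₀ (by positivity) (by positivity)]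
  calc (eigenvectorMoment F V k : ℝ) * (p ^ (k + 1) * N)
      = (p * eigenvectorMoment F V k) * (p ^ k * N) := by ring
    _ ≤ _ := mul_le_mul_of_nonneg_right h (by positivity)

/-- Inclusion-exclusion for the number of endomorphisms without eigenvalues. -/
theorem card_eigenvalue_free_eq :
    (Nat.card {f : Module.End F V // {μ : F | f.HasEigenvalue μ} = ∅} : ℝ) =
      ∑ k ∈ Finset.range (Module.finrank F V + 1),
        (-1 : ℝ) ^ k / (k.factorial : ℝ) * eigenvalueMoment F V k := by
  classical
  have key : ∀ f : Module.End F V,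
      (if {μ : F | f.HasEigenvalue μ} = ∅ then (1 : ℝ) else 0) =
        ∑ k ∈ Finset.range (Module.finrank F V + 1),
          (-1 : ℝ) ^ k / (k.factorial : ℝ) *
            ({μ : F | f.HasEigenvalue μ}.ncard.descFactorial k : ℝ) := fun f => by
    have h1 : ∀ k, (-1 : ℝ) ^ k / (k.factorial : ℝ) *
        ({μ : F | f.HasEigenvalue μ}.ncard.descFactorial k : ℝ) =
        ((((-1) ^ k * ({μ : F | f.HasEigenvalue μ}.ncard.choose k : ℤ) : ℤ)) : ℝ) := fun k => by
      rw [Nat.descFactorial_eq_factorial_mul_choose]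
      have := Nat.factorial_ne_zero k
      push_cast
      field_simp
    simp only [h1]
    -- With n eigenvalues, n at most the dimension, the binomials beyond n vanish. The rest is the
    -- alternating sum of a full row of binomials, which is 0 unless n = 0.
    rw [← Int.cast_sum, ← Finset.sum_subset (Finset.range_subset_range.2
      (Nat.succ_le_succ (ncard_eigenvalues_le_finrank f))), Int.alternating_sum_range_choose]
    · by_cases h0 : {μ : F | f.HasEigenvalue μ} = ∅
      · rw [if_pos h0, if_pos ((Set.ncard_eq_zero).2 h0), Int.cast_one]
      · rw [if_neg h0, if_neg fun h => h0 ((Set.ncard_eq_zero).1 h), Int.cast_zero]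
    · intro k _ hk
      rw [Nat.choose_eq_zero_of_lt (by simpa using hk)]
      simp
  rw [Nat.card_eq_fintype_card, Fintype.card_subtype, ← Finset.sum_boole,
    Finset.sum_congr rfl fun f _ => key f, Finset.sum_comm]
  refine Finset.sum_congr rfl fun k _ => ?_
  rw [eigenvalueMoment, Nat.cast_sum, Finset.mul_sum]

end EigenvalueMoments

/-! ### Asymptotics in q and the truncated exponential series. -/

section Limits

theorem tendsto_natCast_div_natCast_sub_one :
    Tendsto (fun q : ℕ => (q : ℝ) / ((q : ℝ) - 1)) atTop (𝓝 1) := by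
  have h : Tendsto (fun q : ℕ => 1 + ((q : ℝ) - 1)⁻¹) atTop (𝓝 (1 + 0)) :=
    tendsto_const_nhds.add (tendsto_inv_atTop_zero.comp
      (tendsto_atTop_add_const_right _ (-1) tendsto_natCast_atTop_atTop))
  rw [add_zero] at h
  refine h.congr' ?_
  filter_upwards [eventually_gt_atTop 1] with q hq
  have : (0 : ℝ) < (q : ℝ) - 1 := by rw [sub_pos]; exact_mod_cast hq
  field_simp
  ring

theorem tendsto_descFactorial_div (k : ℕ) :
    Tendsto (fun q : ℕ => (q.descFactorial k : ℝ) / ((q : ℝ) - 1) ^ k) atTop (𝓝 1) := by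
  have hi : ∀ i : ℕ, Tendsto (fun q : ℕ => ((q : ℝ) - i) / ((q : ℝ) - 1)) atTop (𝓝 1) := by
    intro i
    have h : Tendsto (fun q : ℕ => (q : ℝ) / ((q : ℝ) - 1) - i * ((q : ℝ) - 1)⁻¹) atTop
        (𝓝 (1 - i * 0)) :=
      tendsto_natCast_div_natCast_sub_one.sub ((tendsto_inv_atTop_zero.comp
        (tendsto_atTop_add_const_right _ (-1) tendsto_natCast_atTop_atTop)).const_mul _)
    rw [mul_zero, sub_zero] at h
    exact h.congr fun q => by rw [sub_div, div_eq_mul_inv (i : ℝ)]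
  have h := tendsto_finsetProd (Finset.range k) fun i _ => hi i
  rw [Finset.prod_const_one] at h
  refine h.congr' ?_
  filter_upwards [eventually_ge_atTop k] with q hq
  rw [Finset.prod_div_distrib, Finset.prod_const, Finset.card_range,
    Nat.descFactorial_eq_prod_range, Nat.cast_prod]
  congr 1
  refine Finset.prod_congr rfl fun i hi => ?_
  rw [Nat.cast_sub ((Finset.mem_range.1 hi).le.trans hq)]

theorem tendsto_one_sub_pow_div_pow {i n : ℕ} (h : i < n) :
    Tendsto (fun q : ℕ => 1 - (q : ℝ) ^ i / (q : ℝ) ^ n) atTop (𝓝 1) := by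
  have := (tendsto_pow_div_pow_atTop_zero (𝕜 := ℝ) h).comp tendsto_natCast_atTop_atTop
  simpa using tendsto_const_nhds.sub this

theorem tendsto_expectedEigenlineTuples {m k : ℕ} (hk : k ≤ m) :
    Tendsto (expectedEigenlineTuples m k) atTop (𝓝 1) := by
  have h := (tendsto_descFactorial_div k).mul (tendsto_finsetProd (Finset.range k) fun i hi =>
    tendsto_one_sub_pow_div_pow ((Finset.mem_range.1 hi).trans_le hk))
  rw [Finset.prod_const_one, mul_one] at h
  exact h

theorem tendsto_pow_div_sub_one_pow_succ (k : ℕ) :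
    Tendsto (fun q : ℕ => (q : ℝ) ^ k / ((q : ℝ) - 1) ^ (k + 1)) atTop (𝓝 0) := by
  have h : Tendsto (fun q : ℕ => ((q : ℝ) / ((q : ℝ) - 1)) ^ k * ((q : ℝ) - 1)⁻¹) atTop
      (𝓝 (1 ^ k * 0)) :=
    (tendsto_natCast_div_natCast_sub_one.pow k).mul (tendsto_inv_atTop_zero.comp
      (tendsto_atTop_add_const_right _ (-1) tendsto_natCast_atTop_atTop))
  rw [mul_zero] at h
  exact h.congr fun q => by rw [div_pow, pow_succ, div_mul_eq_div_div, div_eq_mul_inv _ (_ - _)]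

/-- The number of eigenvalues of a random endomorphism of an `m`-dimensional space over a large
finite field has its factorial moments of order at most `m` close to `1`; hence the proportion of
endomorphisms without eigenvalues tends to the truncated exponential series at `-1`. -/
theorem tendsto_card_eigenvalue_free_div {ι : Type*} {l : Filter ι} {m : ℕ} (K V : ι → Type*)
    [∀ k, Field (K k)] [∀ k, Fintype (K k)] [∀ k, AddCommGroup (V k)] [∀ k, Module (K k) (V k)]
    [∀ k, Fintype (V k)] (hm : ∀ k, Module.finrank (K k) (V k) = m)
    (hK : Tendsto (fun k => Fintype.card (K k)) l atTop) :
    Tendsto (fun k => (Nat.card {f : Module.End (K k) (V k) // {μ | f.HasEigenvalue μ} = ∅} : ℝ) /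
        Nat.card (Module.End (K k) (V k))) l
      (𝓝 (∑ j ∈ Finset.range (m + 1), (-1 : ℝ) ^ j / (j.factorial : ℝ))) := by
  classical
  let _ : ∀ k, Fintype (Module.End (K k) (V k)) := fun k =>
    Fintype.ofInjective (fun f : Module.End (K k) (V k) => (f : V k → V k)) DFunLike.coe_injective
  have hmom : ∀ j ≤ m, Tendsto (fun k => (eigenvalueMoment (K k) (V k) j : ℝ) /
      Nat.card (Module.End (K k) (V k))) l (𝓝 1) := fun j hj => by
    have hhi := (tendsto_expectedEigenlineTuples hj).comp hK
    have hlo := hhi.sub (((tendsto_pow_div_sub_one_pow_succ j).comp hK).const_mul (j : ℝ))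
    rw [mul_zero, sub_zero] at hlo
    refine tendsto_of_tendsto_of_tendsto_of_le_of_le hlo hhi (fun k => ?_) (fun k => ?_)
    · have := le_eigenvalueMoment_div (F := K k) (V := V k) (k := j) ((hm k).symm ▸ hj)
      rwa [hm k] at this
    · have := eigenvalueMoment_div_le (F := K k) (V := V k) (k := j) ((hm k).symm ▸ hj)
      rwa [hm k] at this
  have h := tendsto_finsetSum (Finset.range (m + 1)) fun j hj =>
    (hmom j (Nat.lt_succ_iff.1 (Finset.mem_range.1 hj))).const_mul
      ((-1 : ℝ) ^ j / (j.factorial : ℝ))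
  simp only [mul_one] at h
  refine h.congr fun k => ?_
  rw [card_eigenvalue_free_eq, hm k, Finset.sum_div]
  exact Finset.sum_congr rfl fun j _ => (mul_div_assoc _ _ _).symm

theorem abs_sum_neg_one_pow_div_factorial_sub_le (m : ℕ) :
    |(∑ j ∈ Finset.range (m + 1), (-1 : ℝ) ^ j / (j.factorial : ℝ)) - 1 / Real.exp 1| ≤
      1 / ((m + 1).factorial : ℝ) := by
  -- Two extra terms are kept explicit. They have opposite signs, and the remainder is at most
  -- 1/(m+2)!, so the total is at most 1/(m+1)! - 1/(m+2)! + 1/(m+2)!.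
  have h := Real.exp_bound (x := -1) (by simp) (n := m + 3) (by omega)
  rw [Finset.sum_range_succ, Finset.sum_range_succ, Real.exp_neg, abs_neg, abs_one, one_pow,
    one_mul] at h
  rw [one_div (Real.exp 1)]
  set S := ∑ j ∈ Finset.range (m + 1), (-1 : ℝ) ^ j / (j.factorial : ℝ)
  set e := (Real.exp 1)⁻¹
  have f2 : ((m + 2).factorial : ℝ) = (m + 2) * (m + 1).factorial := by
    rw [Nat.factorial_succ]; push_cast; ring
  have f3 : ((m + 3).factorial : ℝ) = (m + 3) * (m + 2).factorial := by
    rw [Nat.factorial_succ]; push_cast; ring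
  have hpos : (0 : ℝ) < (m + 1).factorial := by positivity
  have hpos2 : (0 : ℝ) < (m + 2).factorial := by positivity
  have hR : ((m + 3).succ : ℝ) / ((m + 3).factorial * ((m + 3 : ℕ) : ℝ)) ≤
      1 / ((m + 2).factorial : ℝ) := by
    rw [f3, div_le_div_iff₀ (by positivity) hpos2]
    push_cast
    have : (0 : ℝ) ≤ m := Nat.cast_nonneg m
    nlinarith [mul_nonneg this hpos2.le, mul_nonneg (mul_nonneg this this) hpos2.le]
  have h21 : 1 / ((m + 2).factorial : ℝ) ≤ 1 / ((m + 1).factorial : ℝ) := by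
    refine one_div_le_one_div_of_le hpos ?_
    rw [f2]
    nlinarith [mul_nonneg (Nat.cast_nonneg (α := ℝ) m) hpos.le]
  have h' := abs_le.1 (h.trans hR)
  rw [abs_le]
  rw [pow_succ _ (m + 1)] at h'
  have hp2 : 0 < 1 / ((m + 2).factorial : ℝ) := by positivity
  rcases neg_one_pow_eq_or ℝ (m + 1) with hs | hs <;> rw [hs] at h' <;> norm_num at h' hp2 h21 ⊢ <;>
    constructor <;> simp only [neg_div, one_div] at h' ⊢ <;> linarith [h'.1, h'.2]

theorem sum_neg_one_pow_div_factorial_mem_Icc {m : ℕ} (hm : 3 ≤ m) :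
    (∑ j ∈ Finset.range (m + 1), (-1 : ℝ) ^ j / (j.factorial : ℝ)) ∈
      Set.Icc (0.333 : ℝ) 0.375 := by
  -- The values 1/3 at m = 3 and 3/8 at m = 4 are too close to the endpoints for the bound 1/(m+1)!;
  -- from m = 5 on the error 1/720 suffices.
  rcases Nat.lt_or_ge m 5 with h5 | h5
  · interval_cases m <;> norm_num [Finset.sum_range_succ, Nat.factorial]
  · have h := abs_le.1 (abs_sum_neg_one_pow_div_factorial_sub_le m)
    have hf : 1 / ((m + 1).factorial : ℝ) ≤ 1 / 720 := by
      refine one_div_le_one_div_of_le (by norm_num) ?_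
      have : Nat.factorial 6 ≤ (m + 1).factorial := Nat.factorial_le (by omega)
      exact_mod_cast this
    have he1 : 1 / Real.exp 1 ≤ 0.37 := by
      rw [div_le_iff₀ (Real.exp_pos 1)]; linarith [Real.exp_one_gt_d9]
    have he2 : 0.36 ≤ 1 / Real.exp 1 := by
      rw [le_div_iff₀ (Real.exp_pos 1)]; linarith [Real.exp_one_lt_d9]
    constructor <;> norm_num at * <;> linarith [h.1, h.2]

end Limits

/-! ### Counting subspaces by their bases. -/

section SubspaceCounting

variable {F V : Type*} [Field F] [AddCommGroup V] [Module F V]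

theorem span_range_subtype_val_eq [Module.Finite F V] {k : ℕ} {C : Submodule F V}
    (hC : Module.finrank F C = k) {u : Fin k → C} (hu : LinearIndependent F u) :
    Submodule.span F (Set.range fun i => (u i : V)) = C := by
  refine Submodule.eq_of_le_of_finrank_eq
    (Submodule.span_le.2 (Set.range_subset_iff.2 fun i => (u i).2)) ?_
  have hu' : LinearIndependent F fun i => (u i : V) := hu.map' C.subtype C.ker_subtype
  rw [finrank_span_eq_card hu', Fintype.card_fin, hC]

/-- Every linearly independent `k`-tuple is a basis of exactly one `k`-dimensional subspace. -/
theorem card_subspaces_mul [Fintype F] [Finite V] {k : ℕ} (hk : k ≤ Module.finrank F V) :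
    Nat.card {C : Submodule F V // Module.finrank F C = k} *
        ∏ i : Fin k, (Fintype.card F ^ k - Fintype.card F ^ (i : ℕ)) =
      ∏ i : Fin k, (Fintype.card F ^ Module.finrank F V - Fintype.card F ^ (i : ℕ)) := by
  classical
  have := Fintype.ofFinite {C : Submodule F V // Module.finrank F C = k}
  rw [← card_linearIndependent hk]
  have hfib : ∀ C : {C : Submodule F V // Module.finrank F C = k},
      Nat.card {u : Fin k → C.1 // LinearIndependent F u} =
        ∏ i : Fin k, (Fintype.card F ^ k - Fintype.card F ^ (i : ℕ)) := fun C => by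
    rw [card_linearIndependent C.2.ge, C.2]
  have hsig : Nat.card (Σ C : {C : Submodule F V // Module.finrank F C = k},
      {u : Fin k → C.1 // LinearIndependent F u}) =
      Nat.card {C : Submodule F V // Module.finrank F C = k} *
        ∏ i : Fin k, (Fintype.card F ^ k - Fintype.card F ^ (i : ℕ)) := by
    rw [Nat.card_sigma, Finset.sum_congr rfl fun C _ => hfib C, Finset.sum_const,
      Nat.card_eq_fintype_card (α := {C : Submodule F V // _}), smul_eq_mul, Finset.card_univ]
  rw [← hsig]
  refine Nat.card_eq_of_bijective (fun p =>
    ⟨fun i => (p.2.1 i : V), p.2.2.map' p.1.1.subtype p.1.1.ker_subtype⟩) ⟨?_, ?_⟩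
  · rintro ⟨⟨C, hC⟩, ⟨u, hu⟩⟩ ⟨⟨C', hC'⟩, ⟨u', hu'⟩⟩ h
    have h' : (fun i => (u i : V)) = fun i => (u' i : V) := congrArg Subtype.val h
    obtain rfl : C = C' := by
      rw [← span_range_subtype_val_eq hC hu, h', span_range_subtype_val_eq hC' hu']
    obtain rfl : u = u' := funext fun i => Subtype.ext (congrFun h' i)
    rfl
  · rintro ⟨v, hv⟩
    exact ⟨⟨⟨Submodule.span F (Set.range v), by rw [finrank_span_eq_card hv, Fintype.card_fin]⟩,
      ⟨fun i => ⟨v i, Submodule.subset_span ⟨i, rfl⟩⟩, linearIndependent_span hv⟩⟩, rfl⟩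

end SubspaceCounting

/-! ### MRD codes and matrices without eigenvalues. -/

section MRDCodes

variable {F : Type*} [Field F] {m : ℕ}

theorem rank_eq_two_iff (A : Matrix (Fin m) (Fin 2) F) :
    A.rank = 2 ↔ LinearIndependent F ![A.col 0, A.col 1] := by
  have h : A.col = ![A.col 0, A.col 1] := by
    funext j; fin_cases j <;> rfl
  rw [← h, linearIndependent_iff_card_eq_finrank_span, Matrix.rank_eq_finrank_span_cols,
    Fintype.card_fin, eq_comm]
  rfl

theorem rankDistance_eq_two_iff (C : RankMetricCode F m 2) :
    rankDistance C = 2 ↔ C ≠ ⊥ ∧ ∀ A ∈ C, A ≠ 0 → A.rank = 2 := by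
  unfold rankDistance
  constructor
  · intro h
    -- The infimum of the empty set is 0, so a positive distance rules out the zero code.
    have hne : {r : ℕ | ∃ A ∈ C, A ≠ 0 ∧ A.rank = r}.Nonempty :=
      Nat.nonempty_of_pos_sInf (by omega)
    obtain ⟨_, A, hA, hA0, -⟩ := hne
    refine ⟨fun hC => hA0 (by rwa [hC, Submodule.mem_bot] at hA), fun B hB hB0 => ?_⟩
    have h1 : B.rank ≤ 2 := by simpa using B.rank_le_width
    have h2 : sInf {r : ℕ | ∃ A ∈ C, A ≠ 0 ∧ A.rank = r} ≤ B.rank := Nat.sInf_le ⟨B, hB, hB0, rfl⟩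
    omega
  · rintro ⟨hC, h⟩
    obtain ⟨A, hA, hA0⟩ := Submodule.exists_mem_ne_zero_of_ne_bot hC
    have hS : {r : ℕ | ∃ A ∈ C, A ≠ 0 ∧ A.rank = r} = {2} := by
      ext r
      constructor
      · rintro ⟨B, hB, hB0, rfl⟩
        exact h B hB hB0
      · rintro rfl
        exact ⟨A, hA, hA0, h A hA hA0⟩
    rw [hS, csInf_singleton]

/-- The codeword of a normalized code with first column `x`. -/
def normalizedEncoder (a : Fin m → Fin m → F) :
    (Fin m → F) →ₗ[F] Matrix (Fin m) (Fin 2) F where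
  toFun x := ∑ α, x α • normalizedGenerator a α
  map_add' x y := by simp [add_smul, Finset.sum_add_distrib]
  map_smul' c x := by simp [mul_smul, Finset.smul_sum]

theorem range_normalizedEncoder (a : Fin m → Fin m → F) :
    LinearMap.range (normalizedEncoder a) = normalizedCode a := by
  ext A
  rw [normalizedCode, Submodule.mem_span_range_iff_exists_fun]
  rfl

theorem col_zero_normalizedEncoder (a : Fin m → Fin m → F) (x : Fin m → F) :
    (normalizedEncoder a x).col 0 = x := by
  funext i
  simp [normalizedEncoder, normalizedGenerator, Matrix.col, Matrix.sum_apply]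

theorem col_one_normalizedEncoder (a : Fin m → Fin m → F) (x : Fin m → F) :
    (normalizedEncoder a x).col 1 = Matrix.toLin' (Matrix.of a).transpose x := by
  funext i
  simp [normalizedEncoder, normalizedGenerator, Matrix.col, Matrix.sum_apply, Matrix.mulVec,
    dotProduct, mul_comm]

theorem normalizedEncoder_injective (a : Fin m → Fin m → F) :
    Function.Injective (normalizedEncoder a) := fun x y h => by
  rw [← col_zero_normalizedEncoder a x, h, col_zero_normalizedEncoder]

theorem finrank_normalizedCode (a : Fin m → Fin m → F) :
    Module.finrank F (normalizedCode a) = m := by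
  rw [← range_normalizedEncoder, LinearMap.finrank_range_of_inj (normalizedEncoder_injective a)]
  simp

theorem normalizedCode_injective :
    Function.Injective (normalizedCode : (Fin m → Fin m → F) → RankMetricCode F m 2) := by
  intro a b h
  funext α i
  have hmem : normalizedEncoder a (Pi.single α 1) ∈ LinearMap.range (normalizedEncoder b) := by
    rw [range_normalizedEncoder, ← h, ← range_normalizedEncoder]
    exact ⟨_, rfl⟩
  obtain ⟨y, hy⟩ := hmem
  obtain rfl : y = Pi.single α 1 := by
    rw [← col_zero_normalizedEncoder b y, hy, col_zero_normalizedEncoder]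
  have h1 := congrFun (congrArg (fun A => Matrix.col A 1) hy) i
  simp only [col_one_normalizedEncoder] at h1
  simpa using h1.symm

/-- The codeword with first column x is (x | Bx), where B is the transpose of `a`. For x ≠ 0 it has
rank 2 unless Bx is a multiple of x. -/
theorem isMRD_normalizedCode_iff (hm : 0 < m) (a : Fin m → Fin m → F) :
    IsMRD (normalizedCode a) 2 ↔ eigenvalueSet (Matrix.of a).transpose = ∅ := by
  have hbot : normalizedCode a ≠ ⊥ := fun h => by
    have := finrank_normalizedCode a
    rw [h, finrank_bot] at this
    omega
  have hdim : Module.finrank F (normalizedCode a) = m * (2 - 2 + 1) := by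
    rw [finrank_normalizedCode]; simp
  rw [IsMRD, and_iff_right hdim, rankDistance_eq_two_iff, and_iff_right hbot]
  have hrank : ∀ x, x ≠ 0 → ((normalizedEncoder a x).rank = 2 ↔
      ∀ c : F, c • x ≠ Matrix.toLin' (Matrix.of a).transpose x) := fun x hx => by
    rw [rank_eq_two_iff, col_zero_normalizedEncoder, col_one_normalizedEncoder,
      LinearIndependent.pair_iff' hx]
  rw [Set.eq_empty_iff_forall_notMem]
  constructor
  · intro h c hc
    obtain ⟨x, hx⟩ := Module.End.HasEigenvalue.exists_hasEigenvector hc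
    refine (hrank x hx.2).1 (h _ ?_ ?_) c hx.apply_eq_smul.symm
    · rw [← range_normalizedEncoder]; exact ⟨x, rfl⟩
    · exact fun h0 => hx.2 (normalizedEncoder_injective a (by rw [h0, map_zero]))
  · intro h A hA hA0
    rw [← range_normalizedEncoder] at hA
    obtain ⟨x, rfl⟩ := hA
    have hx : x ≠ 0 := fun h0 => hA0 (by rw [h0, map_zero])
    exact (hrank x hx).2 fun c hc => h c (Module.End.hasEigenvalue_of_hasEigenvector
      ⟨Module.End.mem_eigenspace_iff.2 hc.symm, hx⟩)

/-- The first-column projection is injective on `C`, hence bijective by dimension; the preimages of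
the standard basis vectors are the normalized generators. -/
theorem IsMRD.exists_eq_normalizedCode {C : RankMetricCode F m 2} (hC : IsMRD C 2) :
    ∃ a, normalizedCode a = C := by
  obtain ⟨hdim, hdist⟩ := hC
  have hrank := ((rankDistance_eq_two_iff C).1 hdist).2
  have hdim' : Module.finrank F C = m := by simpa using hdim
  let π : Matrix (Fin m) (Fin 2) F →ₗ[F] (Fin m → F) :=
    { toFun := fun A => A.col 0
      map_add' := fun _ _ => rfl
      map_smul' := fun _ _ => rfl }
  have hinj : Function.Injective (π.comp C.subtype) := by
    rw [← LinearMap.ker_eq_bot, LinearMap.ker_eq_bot']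
    rintro ⟨A, hA⟩ h0
    by_contra hne
    have hA0 : A ≠ 0 := fun h => hne (Subtype.ext h)
    have hli := (rank_eq_two_iff A).1 (hrank A hA hA0)
    exact hli.ne_zero 0 h0
  have hsurj : Function.Surjective (π.comp C.subtype) :=
    (LinearMap.injective_iff_surjective_of_finrank_eq_finrank (by simp [hdim'])).1 hinj
  choose g hg using fun α : Fin m => hsurj (Pi.single α 1)
  refine ⟨fun α => (g α).1.col 1, Submodule.eq_of_le_of_finrank_eq
    (Submodule.span_le.2 (Set.range_subset_iff.2 fun α => ?_))
    (by rw [finrank_normalizedCode, hdim'])⟩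
  have : normalizedGenerator (fun α => (g α).1.col 1) α = (g α).1 := by
    ext i j
    fin_cases j
    · have : (g α).1 i 0 = (Pi.single α 1 : Fin m → F) i := congrFun (hg α) i
      simpa [normalizedGenerator, Pi.single_apply] using this.symm
    · rfl
  rw [SetLike.mem_coe, this]
  exact (g α).2

theorem ncard_isMRD_normalizedCode (hm : 0 < m) :
    {a : Fin m → Fin m → F | IsMRD (normalizedCode a) 2}.ncard = spectrumFreeCount F m := by
  rw [spectrumFreeCount, ← Nat.card_coe_set_eq, ← Nat.card_coe_set_eq]
  refine Nat.card_congr (Equiv.subtypeEquiv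
    (Matrix.of.trans (Matrix.transposeAddEquiv (Fin m) (Fin m) F).toEquiv) fun a => ?_)
  exact isMRD_normalizedCode_iff hm a

theorem ncard_isMRD (hm : 0 < m) :
    {C : RankMetricCode F m 2 | Module.finrank F C = m ∧ IsMRD C 2}.ncard =
      spectrumFreeCount F m := by
  rw [← ncard_isMRD_normalizedCode hm, ← Set.ncard_image_of_injective _ normalizedCode_injective]
  congr 1
  ext C
  constructor
  · rintro ⟨-, hC⟩
    obtain ⟨a, rfl⟩ := hC.exists_eq_normalizedCode
    exact ⟨a, hC, rfl⟩
  · rintro ⟨a, ha, rfl⟩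
    exact ⟨finrank_normalizedCode a, ha⟩

theorem spectrumFreeCount_eq_card_end :
    spectrumFreeCount F m =
      Nat.card {f : Module.End F (Fin m → F) // {μ : F | f.HasEigenvalue μ} = ∅} := by
  rw [spectrumFreeCount, ← Nat.card_coe_set_eq]
  exact Nat.card_congr (Equiv.subtypeEquiv Matrix.toLin'.toEquiv fun A => Iff.rfl)

variable [Fintype F]

theorem natCard_end_pi :
    Nat.card (Module.End F (Fin m → F)) = Fintype.card F ^ (m ^ 2) := by
  rw [Module.natCard_eq_pow_finrank (K := F), Nat.card_eq_fintype_card, Module.finrank_linearMap]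
  simp [sq]

theorem normalizedMRDProb_eq (hm : 0 < m) :
    normalizedMRDProb F m =
      (spectrumFreeCount F m : ℝ) / (Fintype.card F : ℝ) ^ (m ^ 2) := by
  classical
  let _ : MeasurableSpace F := ⊤
  rw [← ncard_isMRD_normalizedCode hm, normalizedMRDProb]
  set S := {a : Fin m → Fin m → F | IsMRD (normalizedCode a) 2}
  have hS : S = (S.toFinite.toFinset : Set (Fin m → Fin m → F)) :=
    S.toFinite.coe_toFinset.symm
  have hsing : ∀ a : Fin m → Fin m → F, (Measure.pi fun _ : Fin m => Measure.pi fun _ : Fin m =>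
      (PMF.uniformOfFintype F).toMeasure).real {a} = ((Fintype.card F : ℝ) ^ (m ^ 2))⁻¹ := by
    intro a
    rw [Measure.real, Measure.pi_singleton]
    simp only [Measure.pi_singleton, PMF.toMeasure_apply_singleton _ _ (MeasurableSet.singleton _),
      PMF.uniformOfFintype_apply]
    simp [sq, pow_mul]
  rw [hS, ← sum_measureReal_singleton, Finset.sum_congr rfl fun a _ => hsing a, Finset.sum_const,
    Set.ncard_coe_finset, nsmul_eq_mul, div_eq_mul_inv]

theorem cast_prod_pow_sub_pow {k n : ℕ} (hk : k ≤ n) :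
    ((∏ i : Fin k, (Fintype.card F ^ n - Fintype.card F ^ (i : ℕ)) : ℕ) : ℝ) =
      ∏ i ∈ Finset.range k, ((Fintype.card F : ℝ) ^ n - (Fintype.card F : ℝ) ^ i) := by
  rw [← Fin.prod_univ_eq_prod_range
    (fun i => (Fintype.card F : ℝ) ^ n - (Fintype.card F : ℝ) ^ i), Nat.cast_prod]
  refine Finset.prod_congr rfl fun i _ => ?_
  rw [Nat.cast_sub (Nat.pow_le_pow_right Fintype.card_pos (i.2.le.trans hk))]
  push_cast
  rfl

theorem prod_pow_sub_pow_pos {k n : ℕ} (hk : k ≤ n) :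
    0 < ∏ i ∈ Finset.range k, ((Fintype.card F : ℝ) ^ n - (Fintype.card F : ℝ) ^ i) :=
  Finset.prod_pos fun _ hi => sub_pos.2 (pow_lt_pow_right₀
    (by exact_mod_cast Fintype.one_lt_card) ((Finset.mem_range.1 hi).trans_le hk))

theorem ncard_finrank_eq_mul (F : Type*) [Field F] [Fintype F] (m : ℕ) :
    ({C : RankMetricCode F m 2 | Module.finrank F C = m}.ncard : ℝ) *
        ∏ i ∈ Finset.range m, ((Fintype.card F : ℝ) ^ m - (Fintype.card F : ℝ) ^ i) =
      ∏ i ∈ Finset.range m, ((Fintype.card F : ℝ) ^ (2 * m) - (Fintype.card F : ℝ) ^ i) := by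
  have hdim : Module.finrank F (Matrix (Fin m) (Fin 2) F) = 2 * m := by
    simp [Module.finrank_matrix, mul_comm]
  have h := card_subspaces_mul (F := F) (V := Matrix (Fin m) (Fin 2) F) (k := m) (by omega)
  rw [hdim] at h
  rw [← cast_prod_pow_sub_pow le_rfl, ← cast_prod_pow_sub_pow (by omega), ← h, Nat.cast_mul,
    ← Nat.card_coe_set_eq]
  rfl

theorem mrdProportion_eq (hm : 0 < m) :
    mrdProportion F m =
      (spectrumFreeCount F m : ℝ) / (Fintype.card F : ℝ) ^ (m ^ 2) *
        ((∏ i ∈ Finset.range m,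
            ((Fintype.card F : ℝ) ^ (2 * m) - (Fintype.card F : ℝ) ^ (i + m))) /
          (∏ i ∈ Finset.range m,
            ((Fintype.card F : ℝ) ^ (2 * m) - (Fintype.card F : ℝ) ^ i))) := by
  -- Extracting q^m from each factor leaves the number of bases of an m-dimensional space, which
  -- cancels against the subspace count.
  have hnum : ∏ i ∈ Finset.range m,
      ((Fintype.card F : ℝ) ^ (2 * m) - (Fintype.card F : ℝ) ^ (i + m)) =
      (Fintype.card F : ℝ) ^ (m ^ 2) *
        ∏ i ∈ Finset.range m, ((Fintype.card F : ℝ) ^ m - (Fintype.card F : ℝ) ^ i) := by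
    have hconst : (Fintype.card F : ℝ) ^ (m ^ 2) =
        ∏ _i ∈ Finset.range m, (Fintype.card F : ℝ) ^ m := by
      rw [Finset.prod_const, Finset.card_range, sq, pow_mul]
    rw [hconst, ← Finset.prod_mul_distrib]
    exact Finset.prod_congr rfl fun i _ => by ring
  have hP := prod_pow_sub_pow_pos (F := F) (le_refl m)
  have hR := prod_pow_sub_pow_pos (F := F) (k := m) (n := 2 * m) (by omega)
  have hmul := ncard_finrank_eq_mul F m
  have hq : (0 : ℝ) < (Fintype.card F : ℝ) ^ (m ^ 2) :=
    pow_pos (Nat.cast_pos.2 Fintype.card_pos) _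
  rw [mrdProportion, ncard_isMRD hm, hnum, ← hmul]
  rw [← hmul] at hR
  have hN := (pos_iff_pos_of_mul_pos hR).2 hP
  field_simp

end MRDCodes

/-! ### The limiting proportion and the main theorem. -/

theorem tendsto_prod_pow_sub_pow_div (m : ℕ) :
    Tendsto (fun q : ℕ => (∏ i ∈ Finset.range m, ((q : ℝ) ^ (2 * m) - (q : ℝ) ^ (i + m))) /
      ∏ i ∈ Finset.range m, ((q : ℝ) ^ (2 * m) - (q : ℝ) ^ i)) atTop (𝓝 1) := by
  have h : Tendsto (fun q : ℕ => ∏ i ∈ Finset.range m,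
      ((1 - (q : ℝ) ^ (i + m) / (q : ℝ) ^ (2 * m)) / (1 - (q : ℝ) ^ i / (q : ℝ) ^ (2 * m))))
      atTop (𝓝 (∏ _i ∈ Finset.range m, 1 / 1)) := by
    refine tendsto_finsetProd _ fun i hi => ?_
    have := Finset.mem_range.1 hi
    exact (tendsto_one_sub_pow_div_pow (by omega)).div (tendsto_one_sub_pow_div_pow (by omega))
      one_ne_zero
  rw [div_one, Finset.prod_const_one] at h
  refine h.congr' ?_
  filter_upwards [eventually_gt_atTop 0] with q hq
  have hq' : (q : ℝ) ^ (2 * m) ≠ 0 := pow_ne_zero _ (Nat.cast_ne_zero.2 hq.ne')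
  rw [← Finset.prod_div_distrib]
  refine Finset.prod_congr rfl fun i _ => ?_
  rw [one_sub_div hq', one_sub_div hq', div_div_div_cancel_right₀ hq']

theorem mainTheorem4 (m : ℕ) (hm : 2 ≤ m) :
    (∀ (F : Type*) [Field F] [Fintype F],
      normalizedMRDProb F m =
          (spectrumFreeCount F m : ℝ) / (Fintype.card F : ℝ) ^ (m ^ 2) ∧
        mrdProportion F m =
          (spectrumFreeCount F m : ℝ) / (Fintype.card F : ℝ) ^ (m ^ 2) *
            ((∏ i ∈ Finset.range m,
                ((Fintype.card F : ℝ) ^ (2 * m) - (Fintype.card F : ℝ) ^ (i + m))) /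
              (∏ i ∈ Finset.range m,
                ((Fintype.card F : ℝ) ^ (2 * m) - (Fintype.card F : ℝ) ^ i)))) ∧
    (∀ {ι : Type*} (l : Filter ι) (K : ι → Type*) [∀ k, Field (K k)] [∀ k, Fintype (K k)],
      Tendsto (fun k => Fintype.card (K k)) l atTop →
        Tendsto (fun k => normalizedMRDProb (K k) m) l
            (𝓝 (∑ j ∈ Finset.range (m + 1), (-1 : ℝ) ^ j / (j.factorial : ℝ))) ∧
          Tendsto (fun k => mrdProportion (K k) m) l
            (𝓝 (∑ j ∈ Finset.range (m + 1), (-1 : ℝ) ^ j / (j.factorial : ℝ)))) ∧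
    |(∑ j ∈ Finset.range (m + 1), (-1 : ℝ) ^ j / (j.factorial : ℝ)) - 1 / Real.exp 1| ≤
      1 / ((m + 1).factorial : ℝ) ∧
    (3 ≤ m →
      (∑ j ∈ Finset.range (m + 1), (-1 : ℝ) ^ j / (j.factorial : ℝ)) ∈
        Set.Icc (0.333 : ℝ) 0.375) := by
  have hm0 : 0 < m := by omega
  refine ⟨fun F _ _ => ⟨normalizedMRDProb_eq hm0, mrdProportion_eq hm0⟩, ?_,
    abs_sum_neg_one_pow_div_factorial_sub_le m, sum_neg_one_pow_div_factorial_mem_Icc⟩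
  intro ι l K _ _ hK
  have hprob : Tendsto (fun k => normalizedMRDProb (K k) m) l
      (𝓝 (∑ j ∈ Finset.range (m + 1), (-1 : ℝ) ^ j / (j.factorial : ℝ))) := by
    classical
    refine (tendsto_card_eigenvalue_free_div (m := m) K (fun k => Fin m → K k)
      (fun k => by simp) hK).congr fun k => ?_
    rw [normalizedMRDProb_eq hm0, spectrumFreeCount_eq_card_end, natCard_end_pi, Nat.cast_pow]
  refine ⟨hprob, ?_⟩
  -- The proportion is the probability times a factor tending to 1.
  have h := hprob.mul ((tendsto_prod_pow_sub_pow_div m).comp hK)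
  rw [mul_one] at h
  refine h.congr fun k => ?_
  rw [mrdProportion_eq hm0, normalizedMRDProb_eq hm0]
  rfl
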